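/- Let $d\ge 1$, let $\Omega\subset\mathbb{R}^d$ be a bounded open set, let $\varepsilon>0$, let $b\in\mathbb{R}^d$ be a constant vector field, and let $\beta\in L^\infty(\Omega)$ be real-valued with $\tfrac12\operatorname{div}(b)-\beta<0$ a.e. in $\Omega$. Choose an orthonormal coordinate system $x=(x_1,\tilde x)\in\mathbb{R}\times\mathbb{R}^{d-1}$ in which $b=(c,0,\dots,0)$ for some $c\in\mathbb{R}$. For $u,v\in H^1_0(\Omega)$ set $$a(u,v)=\int_\Omega \varepsilon\nabla u\cdot\nabla v+v\,b\cdot\nabla u+\beta uv\,dx .$$ Let $\tilde\omega\subset\mathbb{R}^{d-1}$ be a bounded open set, let $\delta>0$, and put $\tilde\omega_\delta=\{\tilde x\in\mathbb{R}^{d-1}:\operatorname{dist}(\tilde x,\tilde\omega)\le\delta\}$ (the empty set if $\tilde\omega=\emptyset$), $\omega=(\mathbb{R}\times\tilde\omega)\cap\Omega$ and $\omega_\delta=(\mathbb{R}\times\tilde\omega_\delta)\cap\Omega$. Let $$\mathcal{H}(\omega_\delta)=\{v|_{\omega_\delta}: v\in H^1_0(\Omega),\ a(v,\varphi)=0\ \text{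 for all }\varphi\in H^1_0(\omega_\delta)\},$$ where $H^1_0(\omega_\delta)$ is the closure in $H^1$ of the smooth functions with compact support in the interior of $\omega_\delta$, extended by zero to $\Omega$. Then every $u\in\mathcal{H}(\omega_\delta)$ belongs to $L^2(\omega_\delta)$, has a weak gradient $\nabla u$ on the interior of $\omega_\delta$ with $\nabla u\in L^2(\omega)$, and satisfies $$\|\nabla u\|_{L^2(\omega)}^2\le\frac{1}{\delta^2}\,\|u\|_{L^2(\omega_\delta)}^2 .$$ In particular the constant $\delta^{-2}$ does not depend on $\varepsilon$. -/

import Mathlib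

open MeasureTheory Filter Topology
open scoped ENNReal ContDiff Gradient

namespace ConvectionTube

/-- Euclidean space `ℝ^d`. -/
abbrev Euc (d : ℕ) : Type := EuclideanSpace ℝ (Fin d)

/-- `φ ∈ C_c^∞(D)`. -/
structure IsTestFunction {d : ℕ} (D : Set (Euc d)) (φ : Euc d → ℝ) : Prop where
  smooth : ContDiff ℝ ∞ φ
  compact_support : HasCompactSupport φ
  support_subset : tsupport φ ⊆ D

/-- On the open set `D`, the (locally integrable) vector field `g` is the weak gradient of the
(locally integrable) function `u`. -/
structure HasWeakGradient {d : ℕ} (D : Set (Euc d)) (u : Euc d → ℝ) (g : Euc d → Euc d) :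
    Prop where
  locallyIntegrable : LocallyIntegrableOn u D volume
  locallyIntegrable_grad : LocallyIntegrableOn g D volume
  integral_eq : ∀ φ : Euc d → ℝ, IsTestFunction D φ →
    ∫ x in D, u x • gradient φ x = - ∫ x in D, φ x • g x

/-- `u ∈ H^1(D)` for an open set `D`, with weak gradient `g`. Only the values on `D` matter. -/
structure MemH1 {d : ℕ} (D : Set (Euc d)) (u : Euc d → ℝ) (g : Euc d → Euc d) : Prop where
  memLp : MemLp u 2 (volume.restrict D)
  memLp_grad : MemLp g 2 (volume.restrict D)
  weakGradient : HasWeakGradient D u g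

/-- `u ∈ H^1_0(D)` for an open set `D`, with weak gradient `g`: `u` lies in the closure of
`C_c^∞(D)` in `H^1(D)`. Only the values on `D` matter. -/
structure MemH10 {d : ℕ} (D : Set (Euc d)) (u : Euc d → ℝ) (g : Euc d → Euc d) : Prop
    extends MemH1 D u g where
  approx : ∃ φ : ℕ → Euc d → ℝ, (∀ n, IsTestFunction D (φ n)) ∧
    Tendsto (fun n => eLpNorm (fun x => φ n x - u x) 2 (volume.restrict D)) atTop (𝓝 0) ∧
    Tendsto (fun n => eLpNorm (fun x => gradient (φ n) x - g x) 2 (volume.restrict D))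
      atTop (𝓝 0)

/-- The divergence `∑ i, ∂ b_i / ∂ x_i` of a vector field. -/
noncomputable def divergence {d : ℕ} (b : Euc d → Euc d) (x : Euc d) : ℝ :=
  ∑ i : Fin d, fderiv ℝ b x (EuclideanSpace.single i 1) i

/-- The form `a(u, v) = ∫_Ω ε ∇u · ∇v + v (b · ∇u) + β u v`, where `gu` and `gv` stand for the
weak gradients of `u` and `v`. -/
noncomputable def form {d : ℕ} (ε : ℝ) (b : Euc d → Euc d) (β : Euc d → ℝ) (Ω : Set (Euc d))
    (u : Euc d → ℝ) (gu : Euc d → Euc d) (v : Euc d → ℝ) (gv : Euc d → Euc d) : ℝ :=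
  ∫ x in Ω, ε * inner ℝ (gu x) (gv x) + v x * inner ℝ (b x) (gu x) + β x * u x * v x

/-- The space of functions that are `a`-harmonic on `D ⊆ Ω`: restrictions to `D` of functions
`v ∈ H^1_0(Ω)` with `a(v, φ) = 0` for all `φ ∈ H^1_0(D)`. Here `φ` and `∇φ` are extended by zero
to `Ω`, and `H^1_0(D)` is built on the interior of `D` when `D` is not open. Only the values of a
member on `D` matter. -/
def harmonicSpace {d : ℕ} (ε : ℝ) (b : Euc d → Euc d) (β : Euc d → ℝ) (Ω D : Set (Euc d)) :
    Set (Euc d → ℝ) :=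
  {u | ∃ (v : Euc d → ℝ) (gv : Euc d → Euc d), MemH10 Ω v gv ∧
    (∀ (φ : Euc d → ℝ) (gφ : Euc d → Euc d), MemH10 (interior D) φ gφ →
      form ε b β Ω v gv ((interior D).indicator φ) ((interior D).indicator gφ) = 0) ∧
    u =ᵐ[volume.restrict D] v}

/-- The coordinates of `x` other than the first one, in the coordinate system given by the linear
isometry `R`. -/
noncomputable def transverse {m : ℕ} (R : Euc (m + 1) ≃ₗᵢ[ℝ] Euc (m + 1)) (x : Euc (m + 1)) :
    Euc m :=
  WithLp.toLp 2 (fun i : Fin m => R x i.succ)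

/-- The tube `(ℝ × S) ∩ Ω`, where `ℝ × S` is taken in the coordinates given by `R`. -/
def tube {m : ℕ} (R : Euc (m + 1) ≃ₗᵢ[ℝ] Euc (m + 1)) (Ω : Set (Euc (m + 1)))
    (S : Set (Euc m)) : Set (Euc (m + 1)) :=
  {x | transverse R x ∈ S} ∩ Ω

end ConvectionTube

/-!
An `a`-harmonic function `v` on the enlarged tube is tested with `η² v`, where `η` is a smooth cutoff
depending only on the coordinates transverse to `b`, equal to `1` over `S` and supported over the
open `δ`-thickening of `S`.

Because `η` is constant along `b` and `b` is constant, the convective term `∫ η² v (b · ∇v)` is half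
the integral of the divergence of `η² v² b`, hence vanishes
(`MemH10.integral_convection_eq_zero`). The diffusion term is rewritten by
`∇v · ∇(η² v) = |∇(η v)|² - v² |∇η|²` (`inner_cutoff_sq`), which gives the energy identity
`ε ∫ |∇(η v)|² + ∫ β η² v² = ε ∫ v² |∇η|²` (`energy_identity`). As `div b = 0`, the hypothesis on the
coefficients says `β > 0`, so `∫ |∇(η v)|² ≤ ∫ v² |∇η|²` and `ε` has cancelled. Working with `∇(η v)`
instead of absorbing the cross term `2 η v ∇v · ∇η` is what gives the constant `1` in front of
`δ⁻²`. Over `S` one has `∇(η v) = ∇v`, and `|∇η| ≤ L` can be achieved for every `L > 1 / δ` by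
mollifying a truncated distance function (`exists_smooth_cutoff`, `exists_tube_cutoff`); letting
`L` tend to `1 / δ` gives the estimate.

That `η² v` is an admissible test function is `MemH10.cutoff`. The estimate holds for every weak
gradient of `u` because weak gradients are unique almost everywhere (`HasWeakGradient.ae_eq`).
-/

namespace ConvectionTube

/-! ### Smooth cutoffs with almost optimal slope -/

open scoped Convolution in
/-- Averaging translates of a Lipschitz function against a probability density keeps its Lipschitz
constant. -/
theorem lipschitzWith_normed_convolution {E : Type*} [NormedAddCommGroup E] [NormedSpace ℝ E]
    [FiniteDimensional ℝ E] [MeasurableSpace E] [BorelSpace E] {μ : Measure E} [μ.IsAddHaarMeasure]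
    {K : NNReal} {f : E → ℝ} (hf : LipschitzWith K f) (ρ : ContDiffBump (0 : E)) :
    LipschitzWith K (ρ.normed μ ⋆[ContinuousLinearMap.lsmul ℝ ℝ, μ] f) := by
  have hint (x : E) : Integrable (fun t => ρ.normed μ t • f (x - t)) μ :=
    (ρ.continuous_normed.smul (hf.continuous.comp (continuous_const.sub continuous_id)))
      |>.integrable_of_hasCompactSupport ρ.hasCompactSupport_normed.smul_right
  refine LipschitzWith.of_dist_le_mul fun x y => ?_
  rw [Real.dist_eq]
  simp only [convolution, ContinuousLinearMap.lsmul_apply]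
  rw [← integral_sub (hint x) (hint y), ← Real.norm_eq_abs]
  refine (norm_integral_le_of_norm_le (ρ.integrable_normed.mul_const (K * dist x y))
    (ae_of_all _ fun t => ?_)).trans_eq ?_
  · rw [← smul_sub, norm_smul, Real.norm_of_nonneg (ρ.nonneg_normed t)]
    refine mul_le_mul_of_nonneg_left ?_ (ρ.nonneg_normed t)
    simpa [Real.dist_eq] using hf.dist_le_mul (x - t) (y - t)
  · rw [integral_mul_const, ρ.integral_normed, one_mul]

open scoped Convolution in
/-- A smooth function that is `1` on `S`, vanishes at distance `δ` from `S`, and whose gradient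
exceeds `1 / δ` by as little as desired. It is a mollified truncation of the distance to `S`. -/
theorem exists_smooth_cutoff {m : ℕ} {S : Set (Euc m)} (hne : S.Nonempty) {δ L : ℝ} (hδ : 0 < δ)
    (hL : 1 / δ < L) :
    ∃ θ : Euc m → ℝ, ContDiff ℝ ∞ θ ∧ (∀ x ∈ S, θ x = 1) ∧ tsupport θ ⊆ Metric.thickening δ S ∧
      (∀ x, |θ x| ≤ 1) ∧ LipschitzWith L.toNNReal θ := by
  have hL0 : 0 < L := (one_div_pos.2 hδ).trans hL
  -- The slope `L` leaves the width `δ - 1 / L = 3 r` to spare: `r` for each of the two mollified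
  -- edges and `r` to keep the support inside the open thickening.
  set r : ℝ := (δ - 1 / L) / 3 with hr
  have hr0 : 0 < r := by
    have : 1 / L < δ := by rwa [one_div_lt hL0 hδ]
    rw [hr]; linarith
  have hLr : L * (δ - 3 * r) = 1 := by rw [hr]; field_simp; ring
  set f : Euc m → ℝ := fun y => max 0 (min 1 (L * (δ - 2 * r - Metric.infDist y S))) with hf
  have hlip : LipschitzWith L.toNNReal f := by
    refine LipschitzWith.const_max (LipschitzWith.const_min ?_ 1) 0
    refine LipschitzWith.of_dist_le_mul fun x y => ?_
    have h := (Metric.lipschitz_infDist_pt S).dist_le_mul x y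
    rw [Real.dist_eq] at h ⊢
    rw [Real.coe_toNNReal _ hL0.le, ← mul_sub, abs_mul, abs_of_pos hL0]
    refine mul_le_mul_of_nonneg_left ?_ hL0.le
    rw [abs_sub_comm]
    simpa using h
  have hf01 (y : Euc m) : |f y| ≤ 1 := by
    rw [abs_of_nonneg (le_max_left _ _)]
    exact max_le zero_le_one (min_le_left _ _)
  have hfone (y : Euc m) (hy : Metric.infDist y S ≤ r) : f y = 1 := by
    have : 1 ≤ L * (δ - 2 * r - Metric.infDist y S) := by
      rw [← hLr]; exact mul_le_mul_of_nonneg_left (by linarith) hL0.le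
    simp [hf, min_eq_left this]
  have hfzero (y : Euc m) (hy : δ - 2 * r ≤ Metric.infDist y S) : f y = 0 := by
    have : L * (δ - 2 * r - Metric.infDist y S) ≤ 0 :=
      mul_nonpos_of_nonneg_of_nonpos hL0.le (by linarith)
    simp only [hf]
    exact max_eq_left ((min_le_right _ _).trans this)
  let ρ : ContDiffBump (0 : Euc m) := ⟨r / 2, r, by positivity, by linarith⟩
  have hball (x y : Euc m) (hy : y ∈ Metric.ball x ρ.rOut) :
      |Metric.infDist y S - Metric.infDist x S| < r := by
    have h := (Metric.lipschitz_infDist_pt S).dist_le_mul y x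
    rw [Real.dist_eq] at h
    refine lt_of_le_of_lt (by simpa using h) hy
  set θ : Euc m → ℝ := ρ.normed volume ⋆[ContinuousLinearMap.lsmul ℝ ℝ, volume] f with hθ
  have hθone (x : Euc m) (hx : x ∈ S) : θ x = 1 := by
    have h0 : Metric.infDist x S = 0 := Metric.infDist_zero_of_mem hx
    have h1 : ∀ y ∈ Metric.ball x ρ.rOut, f y = f x := fun y hy => by
      have := (abs_lt.1 (hball x y hy)).2
      rw [hfone y (by linarith), hfone x (by linarith)]
    rw [hθ, ContDiffBump.normed_convolution_eq_right h1, hfone x (by linarith)]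
  have hθzero (x : Euc m) (hx : δ - r ≤ Metric.infDist x S) : θ x = 0 := by
    have h1 : ∀ y ∈ Metric.ball x ρ.rOut, f y = f x := fun y hy => by
      have := (abs_lt.1 (hball x y hy)).1
      rw [hfzero y (by linarith), hfzero x (by linarith)]
    rw [hθ, ContDiffBump.normed_convolution_eq_right h1, hfzero x (by linarith)]
  refine ⟨θ, ρ.hasCompactSupport_normed.contDiff_convolution_left _ ρ.contDiff_normed
    hlip.continuous.locallyIntegrable, hθone, ?_, fun x => ?_,
    lipschitzWith_normed_convolution hlip ρ⟩
  · have hcl : tsupport θ ⊆ {x | Metric.infDist x S ≤ δ - r} := by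
      refine closure_minimal (fun x hx => ?_)
        (isClosed_le (Metric.continuous_infDist_pt S) continuous_const)
      by_contra h
      exact hx (hθzero x (not_le.1 h).le)
    intro x hx
    have := hcl hx
    rw [Metric.thickening_eq_biUnion_ball]
    obtain ⟨y, hy, hxy⟩ := (Metric.infDist_lt_iff hne).1
      (lt_of_le_of_lt this (by linarith : δ - r < δ))
    exact Set.mem_biUnion hy hxy
  · have := dist_convolution_le (μ := volume) (g := f) (x₀ := x) (z₀ := 0) zero_le_one
      ρ.support_normed_eq.subset ρ.nonneg_normed ρ.integral_normed
      hlip.continuous.aestronglyMeasurable (fun y _ => by simpa using hf01 y)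
    simpa using this

/-! ### Pairings of square integrable functions -/

theorem integrable_smul_of_memLp_two {α E : Type*} [MeasurableSpace α] {μ : Measure α}
    [NormedAddCommGroup E] [NormedSpace ℝ E] {f : α → ℝ} {h : α → E} (hf : MemLp f 2 μ)
    (hh : MemLp h 2 μ) : Integrable (fun x => f x • h x) μ :=
  memLp_one_iff_integrable.1 (hh.smul hf)

/-- `∫ φₙ h → ∫ f h` when `φₙ → f` in `L²` and `h ∈ L²`. -/
theorem tendsto_integral_smul_left {α E : Type*} [MeasurableSpace α] {μ : Measure α}
    [NormedAddCommGroup E] [NormedSpace ℝ E] {φ : ℕ → α → ℝ} {f : α → ℝ} {h : α → E}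
    (hφ : ∀ n, MemLp (φ n) 2 μ) (hf : MemLp f 2 μ) (hh : MemLp h 2 μ)
    (hlim : Tendsto (fun n => eLpNorm (fun x => φ n x - f x) 2 μ) atTop (𝓝 0)) :
    Tendsto (fun n => ∫ x, φ n x • h x ∂μ) atTop (𝓝 (∫ x, f x • h x ∂μ)) := by
  refine tendsto_integral_of_L1' _ (integrable_smul_of_memLp_two hf hh).aestronglyMeasurable
    (Eventually.of_forall fun n => integrable_smul_of_memLp_two (hφ n) hh) ?_
  have hz := ENNReal.Tendsto.mul_const (b := eLpNorm h 2 μ) hlim (Or.inr hh.eLpNorm_ne_top)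
  rw [zero_mul] at hz
  refine tendsto_of_tendsto_of_tendsto_of_le_of_le tendsto_const_nhds hz (fun _ => zero_le)
    fun n => ?_
  refine le_trans (le_of_eq ?_) (eLpNorm_smul_le_mul_eLpNorm (p := 2) (q := 2) (r := 1) hh.1
    ((hφ n).sub hf).1)
  congr 1
  ext x
  simp [sub_smul]

/-- `∫ f Gₙ → ∫ f G` when `Gₙ → G` in `L²` and `f ∈ L²`. -/
theorem tendsto_integral_smul_right {α E : Type*} [MeasurableSpace α] {μ : Measure α}
    [NormedAddCommGroup E] [NormedSpace ℝ E] {f : α → ℝ} {G : ℕ → α → E} {g : α → E}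
    (hG : ∀ n, MemLp (G n) 2 μ) (hf : MemLp f 2 μ) (hg : MemLp g 2 μ)
    (hlim : Tendsto (fun n => eLpNorm (fun x => G n x - g x) 2 μ) atTop (𝓝 0)) :
    Tendsto (fun n => ∫ x, f x • G n x ∂μ) atTop (𝓝 (∫ x, f x • g x ∂μ)) := by
  refine tendsto_integral_of_L1' _ (integrable_smul_of_memLp_two hf hg).aestronglyMeasurable
    (Eventually.of_forall fun n => integrable_smul_of_memLp_two hf (hG n)) ?_
  have hz := ENNReal.Tendsto.const_mul (a := eLpNorm f 2 μ) hlim (Or.inr hf.eLpNorm_ne_top)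
  rw [mul_zero] at hz
  refine tendsto_of_tendsto_of_tendsto_of_le_of_le tendsto_const_nhds hz (fun _ => zero_le)
    fun n => ?_
  refine le_trans (le_of_eq ?_) (eLpNorm_smul_le_mul_eLpNorm (p := 2) (q := 2) (r := 1)
    ((hG n).sub hg).1 hf.1)
  congr 1
  ext x
  simp [smul_sub]

/-! ### Classical gradients and test functions -/

section Gradient

variable {d : ℕ}

theorem gradient_mul {f g : Euc d → ℝ} {x : Euc d} (hf : DifferentiableAt ℝ f x)
    (hg : DifferentiableAt ℝ g x) :
    gradient (fun y => f y * g y) x = f x • gradient g x + g x • gradient f x := by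
  simp only [gradient]
  rw [fderiv_fun_mul hf hg]
  simp

theorem continuous_gradient {f : Euc d → ℝ} (hf : ContDiff ℝ ∞ f) : Continuous (gradient f) :=
  (InnerProductSpace.toDual ℝ (Euc d)).symm.continuous.comp (hf.continuous_fderiv (by simp))

theorem tsupport_gradient_subset (f : Euc d → ℝ) : tsupport (gradient f) ⊆ tsupport f := by
  refine (closure_mono fun x hx => ?_).trans (tsupport_fderiv_subset ℝ)
  simpa [gradient] using hx

theorem gradient_eq_zero_of_notMem_tsupport {f : Euc d → ℝ} {x : Euc d} (hx : x ∉ tsupport f) :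
    gradient f x = 0 :=
  image_eq_zero_of_notMem_tsupport fun h => hx (tsupport_gradient_subset f h)

end Gradient

section TestFunction

variable {d : ℕ} {D Ω : Set (Euc d)} {φ ζ : Euc d → ℝ}

theorem IsTestFunction.mono (h : IsTestFunction D φ) (hD : D ⊆ Ω) : IsTestFunction Ω φ :=
  ⟨h.smooth, h.compact_support, h.support_subset.trans hD⟩

theorem IsTestFunction.memLp (h : IsTestFunction D φ) (μ : Measure (Euc d))
    [IsFiniteMeasureOnCompacts μ] : MemLp φ 2 μ :=
  h.smooth.continuous.memLp_of_hasCompactSupport h.compact_support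

theorem IsTestFunction.memLp_gradient (h : IsTestFunction D φ) (μ : Measure (Euc d))
    [IsFiniteMeasureOnCompacts μ] : MemLp (gradient φ) 2 μ :=
  (continuous_gradient h.smooth).memLp_of_hasCompactSupport
    (h.compact_support.mono' ((subset_tsupport _).trans (tsupport_gradient_subset φ)))

/-- A test function on `Ω` times a smooth function supported, within `Ω`, in `D` is a test function
on `D`. -/
theorem IsTestFunction.smooth_mul (h : IsTestFunction Ω φ) (hζ : ContDiff ℝ ∞ ζ)
    (hsupp : tsupport ζ ∩ Ω ⊆ D) : IsTestFunction D (fun x => ζ x * φ x) where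
  smooth := hζ.mul h.smooth
  compact_support := h.compact_support.mul_left
  support_subset := fun _ hx => hsupp
    ⟨tsupport_mul_subset_left hx, h.support_subset (tsupport_mul_subset_right hx)⟩

end TestFunction

/-! ### Multipliers bounded in `C¹` -/

/-- A smooth function that is bounded by `C` together with its gradient. -/
structure IsC1Bounded {d : ℕ} (C : ℝ) (ζ : Euc d → ℝ) : Prop where
  smooth : ContDiff ℝ ∞ ζ
  abs_le : ∀ x, |ζ x| ≤ C
  norm_gradient_le : ∀ x, ‖gradient ζ x‖ ≤ C

section IsC1Bounded

variable {d : ℕ} {C : ℝ} {ζ : Euc d → ℝ} {μ : Measure (Euc d)}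

theorem IsC1Bounded.gradient_sq (h : IsC1Bounded C ζ) (x : Euc d) :
    gradient (fun y => ζ y ^ 2) x = (2 * ζ x) • gradient ζ x := by
  have hd : DifferentiableAt ℝ ζ x := (h.smooth.differentiable (by simp)) x
  simp_rw [sq]
  rw [gradient_mul hd hd, ← add_smul, two_mul]

theorem IsC1Bounded.sq (h : IsC1Bounded C ζ) : IsC1Bounded (2 * C ^ 2) (fun x => ζ x ^ 2) where
  smooth := h.smooth.pow 2
  abs_le x := by
    rw [abs_pow]
    have := pow_le_pow_left₀ (abs_nonneg _) (h.abs_le x) 2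
    nlinarith [sq_nonneg C]
  norm_gradient_le x := by
    have hC : 0 ≤ C := (abs_nonneg _).trans (h.abs_le x)
    rw [h.gradient_sq, norm_smul, Real.norm_eq_abs, abs_mul, abs_two, mul_assoc, pow_two]
    have := mul_le_mul (h.abs_le x) (h.norm_gradient_le x) (norm_nonneg _) hC
    linarith

theorem IsC1Bounded.memLp_smul {E : Type*} [NormedAddCommGroup E] [NormedSpace ℝ E]
    (h : IsC1Bounded C ζ) {f : Euc d → E} (hf : MemLp f 2 μ) :
    MemLp (fun x => ζ x • f x) 2 μ :=
  hf.of_le_mul (c := C) (h.smooth.continuous.aestronglyMeasurable.smul hf.1)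
    (ae_of_all _ fun x => by
      rw [norm_smul]; exact mul_le_mul_of_nonneg_right (h.abs_le x) (norm_nonneg _))

theorem IsC1Bounded.memLp_smul_gradient (h : IsC1Bounded C ζ) {f : Euc d → ℝ} (hf : MemLp f 2 μ) :
    MemLp (fun x => f x • gradient ζ x) 2 μ :=
  hf.of_le_mul (c := C) (hf.1.smul (continuous_gradient h.smooth).aestronglyMeasurable)
    (ae_of_all _ fun x => by
      rw [norm_smul, mul_comm]
      exact mul_le_mul_of_nonneg_right (h.norm_gradient_le x) (norm_nonneg _))

end IsC1Bounded

/-! ### Weak gradients -/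

section WeakGradient

variable {d : ℕ} {D Ω : Set (Euc d)} {v : Euc d → ℝ} {gv : Euc d → Euc d}

/-- Square integrable functions satisfying the integration by parts identity have a weak gradient:
the local integrability comes for free. -/
theorem hasWeakGradient_of_memLp (hv : MemLp v 2 (volume.restrict D))
    (hg : MemLp gv 2 (volume.restrict D))
    (h : ∀ φ : Euc d → ℝ, IsTestFunction D φ →
      ∫ x in D, v x • gradient φ x = - ∫ x in D, φ x • gv x) : HasWeakGradient D v gv :=
  ⟨locallyIntegrableOn_of_locallyIntegrable_restrict (hv.locallyIntegrable one_le_two),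
    locallyIntegrableOn_of_locallyIntegrable_restrict (hg.locallyIntegrable one_le_two), h⟩

theorem IsTestFunction.setIntegral_smul_eq {φ : Euc d → ℝ} (hφ : IsTestFunction D φ)
    (hΩ : MeasurableSet Ω) (hD : D ⊆ Ω) (g : Euc d → Euc d) :
    ∫ x in D, φ x • g x = ∫ x in Ω, φ x • g x := by
  refine (setIntegral_eq_of_subset_of_forall_sdiff_eq_zero hΩ hD fun x hx => ?_).symm
  rw [image_eq_zero_of_notMem_tsupport fun h => hx.2 (hφ.support_subset h), zero_smul]

theorem IsTestFunction.setIntegral_smul_gradient_eq {φ : Euc d → ℝ} (hφ : IsTestFunction D φ)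
    (hΩ : MeasurableSet Ω) (hD : D ⊆ Ω) (u : Euc d → ℝ) :
    ∫ x in D, u x • gradient φ x = ∫ x in Ω, u x • gradient φ x := by
  refine (setIntegral_eq_of_subset_of_forall_sdiff_eq_zero hΩ hD fun x hx => ?_).symm
  rw [gradient_eq_zero_of_notMem_tsupport fun h => hx.2 (hφ.support_subset h), smul_zero]

theorem HasWeakGradient.mono (h : HasWeakGradient Ω v gv) (hΩ : MeasurableSet Ω) (hD : D ⊆ Ω) :
    HasWeakGradient D v gv where
  locallyIntegrable := h.locallyIntegrable.mono_set hD
  locallyIntegrable_grad := h.locallyIntegrable_grad.mono_set hD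
  integral_eq φ hφ := by
    rw [hφ.setIntegral_smul_gradient_eq hΩ hD, hφ.setIntegral_smul_eq hΩ hD,
      h.integral_eq φ (hφ.mono hD)]

theorem IsTestFunction.integrableOn_smul {φ : Euc d → ℝ} (hφ : IsTestFunction D φ)
    {g : Euc d → Euc d} (hg : LocallyIntegrableOn g D volume) :
    IntegrableOn (fun x => φ x • g x) D := by
  have hK : IsCompact (tsupport φ) := hφ.compact_support
  have h1 : IntegrableOn (fun x => φ x • g x) (tsupport φ) :=
    (hg.integrableOn_compact_subset hφ.support_subset hK).continuousOn_smul
      hφ.smooth.continuous.continuousOn hK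
  refine ((integrableOn_iff_integrable_of_support_subset fun x hx => ?_).1 h1).integrableOn
  by_contra h
  exact hx (by simp [image_eq_zero_of_notMem_tsupport h])

/-- Weak gradients on an open set are unique up to null sets. -/
theorem HasWeakGradient.ae_eq {u w : Euc d → ℝ} {g h : Euc d → Euc d} (hD : IsOpen D)
    (hu : HasWeakGradient D u g) (hw : HasWeakGradient D w h)
    (huw : u =ᵐ[volume.restrict D] w) : g =ᵐ[volume.restrict D] h := by
  have key := hD.ae_eq_zero_of_integral_contDiff_smul_eq_zero (μ := volume)
    (hu.locallyIntegrable_grad.sub hw.locallyIntegrable_grad) fun φ h1 h2 h3 => by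
      have hφ : IsTestFunction D φ := ⟨h1, h2, h3⟩
      rw [← setIntegral_univ, ← hφ.setIntegral_smul_eq MeasurableSet.univ (Set.subset_univ _)]
      simp only [Pi.sub_apply, smul_sub]
      rw [integral_sub (hφ.integrableOn_smul hu.locallyIntegrable_grad)
        (hφ.integrableOn_smul hw.locallyIntegrable_grad), ← neg_inj (a := _ - _), neg_sub',
        ← hu.integral_eq φ hφ, ← hw.integral_eq φ hφ, neg_zero, sub_eq_zero]
      refine integral_congr_ae ?_
      filter_upwards [huw] with x hx
      rw [hx]
  refine (ae_restrict_iff' hD.measurableSet).2 ?_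
  filter_upwards [key] with x hx hxD
  exact sub_eq_zero.1 (hx hxD)

end WeakGradient

/-! ### Cutoffs of functions in `H^1_0` -/

section Cutoff

variable {d : ℕ} {D Ω : Set (Euc d)} {v ζ : Euc d → ℝ} {gv : Euc d → Euc d} {C : ℝ}

theorem IsC1Bounded.gradient_mul_test (hζ : IsC1Bounded C ζ) {φ : Euc d → ℝ}
    (hφ : IsTestFunction D φ) (x : Euc d) :
    gradient (fun y => ζ y * φ y) x = ζ x • gradient φ x + φ x • gradient ζ x :=
  gradient_mul (hζ.smooth.differentiable (by simp) x) (hφ.smooth.differentiable (by simp) x)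

/-- The product rule for a weakly differentiable function and a smooth cutoff, in integrated form:
`∫ v ζ ∇φ + ∫ φ v ∇ζ = - ∫ ζ φ ∇v`. -/
theorem MemH1.integral_cutoff (h : MemH1 Ω v gv) (hζ : IsC1Bounded C ζ) {φ : Euc d → ℝ}
    (hφ : IsTestFunction Ω φ) :
    (∫ x in Ω, (ζ x • v x) • gradient φ x) + ∫ x in Ω, φ x • v x • gradient ζ x =
      - ∫ x in Ω, φ x • ζ x • gv x := by
  have ht : IsTestFunction Ω (fun x => ζ x * φ x) :=
    hφ.smooth_mul hζ.smooth Set.inter_subset_right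
  have := h.weakGradient.integral_eq _ ht
  rw [← integral_add
    (integrable_smul_of_memLp_two (hζ.memLp_smul h.memLp) (hφ.memLp_gradient _))
    (integrable_smul_of_memLp_two (hφ.memLp _) (hζ.memLp_smul_gradient h.memLp))]
  simp only [hζ.gradient_mul_test hφ] at this
  calc _ = ∫ x in Ω, v x • (ζ x • gradient φ x + φ x • gradient ζ x) :=
        integral_congr_ae (ae_of_all _ fun x => by simp only [smul_eq_mul]; module)
    _ = - ∫ x in Ω, (ζ x * φ x) • gv x := this
    _ = _ := congrArg _ (integral_congr_ae (ae_of_all _ fun x => by simp only; module))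

/-- Multiplication by a smooth cutoff supported in `D` maps `H^1_0(Ω)` to `H^1_0(D)`. -/
theorem MemH10.cutoff (h : MemH10 Ω v gv) (hζ : IsC1Bounded C ζ) (hΩ : MeasurableSet Ω)
    (hD : D ⊆ Ω) (hsupp : tsupport ζ ∩ Ω ⊆ D) :
    MemH10 D (fun x => ζ x * v x) (fun x => ζ x • gv x + v x • gradient ζ x) := by
  have hμ : volume.restrict D ≤ volume.restrict Ω := Measure.restrict_mono hD le_rfl
  have hv : MemLp v 2 (volume.restrict D) := h.memLp.mono_measure hμ
  have hg : MemLp gv 2 (volume.restrict D) := h.memLp_grad.mono_measure hμ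
  have hw : MemLp (fun x => ζ x * v x) 2 (volume.restrict D) := hζ.memLp_smul hv
  have hgw : MemLp (fun x => ζ x • gv x + v x • gradient ζ x) 2 (volume.restrict D) :=
    (hζ.memLp_smul hg).add (hζ.memLp_smul_gradient hv)
  refine ⟨⟨hw, hgw, hasWeakGradient_of_memLp hw hgw fun φ hφ => ?_⟩, ?_⟩
  · have key := h.toMemH1.integral_cutoff hζ (hφ.mono hD)
    rw [hφ.setIntegral_smul_gradient_eq hΩ hD, hφ.setIntegral_smul_eq hΩ hD]
    simp only [smul_add, smul_eq_mul] at key ⊢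
    have hφ2 : MemLp φ 2 (volume.restrict Ω) := hφ.memLp _
    rw [integral_add (integrable_smul_of_memLp_two hφ2 (hζ.memLp_smul h.memLp_grad))
      (integrable_smul_of_memLp_two hφ2 (hζ.memLp_smul_gradient h.memLp)), neg_add,
      ← key, add_neg_cancel_right]
  · obtain ⟨φ, hφ, hlim, hlim'⟩ := h.approx
    replace hlim := tendsto_of_tendsto_of_tendsto_of_le_of_le tendsto_const_nhds hlim
      (fun _ => zero_le) fun n => eLpNorm_mono_measure (fun x => φ n x - v x) hμ
    replace hlim' := tendsto_of_tendsto_of_tendsto_of_le_of_le tendsto_const_nhds hlim'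
      (fun _ => zero_le) fun n => eLpNorm_mono_measure (fun x => gradient (φ n) x - gv x) hμ
    have hC := ENNReal.Tendsto.const_mul (a := ENNReal.ofReal C) hlim
      (Or.inr ENNReal.ofReal_ne_top)
    have hC' := ENNReal.Tendsto.const_mul (a := ENNReal.ofReal C) hlim'
      (Or.inr ENNReal.ofReal_ne_top)
    rw [mul_zero] at hC hC'
    have hsum := hC'.add hC
    rw [add_zero] at hsum
    refine ⟨fun n x => ζ x * φ n x, fun n => (hφ n).smooth_mul hζ.smooth hsupp, ?_, ?_⟩
    · refine tendsto_of_tendsto_of_tendsto_of_le_of_le tendsto_const_nhds hC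
        (fun _ => zero_le) fun n => ?_
      refine eLpNorm_le_mul_eLpNorm_of_ae_le_mul (ae_of_all _ fun x => ?_) 2
      rw [← mul_sub, norm_mul]
      exact mul_le_mul_of_nonneg_right (hζ.abs_le x) (norm_nonneg _)
    · refine tendsto_of_tendsto_of_tendsto_of_le_of_le tendsto_const_nhds hsum
        (fun _ => zero_le) fun n => ?_
      have hd : MemLp (fun x => φ n x - v x) 2 (volume.restrict D) := ((hφ n).memLp _).sub hv
      have hd' : MemLp (fun x => gradient (φ n) x - gv x) 2 (volume.restrict D) :=
        ((hφ n).memLp_gradient _).sub hg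
      have heq : (fun x => gradient (fun y => ζ y * φ n y) x
            - (ζ x • gv x + v x • gradient ζ x)) =
          (fun x => ζ x • (gradient (φ n) x - gv x)) +
            fun x => (φ n x - v x) • gradient ζ x := by
        ext1 x
        rw [hζ.gradient_mul_test (hφ n), Pi.add_apply]
        module
      rw [heq]
      refine (eLpNorm_add_le (hζ.memLp_smul hd').1 (hζ.memLp_smul_gradient hd).1
        one_le_two).trans (add_le_add ?_ ?_)
      · refine eLpNorm_le_mul_eLpNorm_of_ae_le_mul (ae_of_all _ fun x => ?_) 2
        rw [norm_smul]
        exact mul_le_mul_of_nonneg_right (hζ.abs_le x) (norm_nonneg _)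
      · refine eLpNorm_le_mul_eLpNorm_of_ae_le_mul (ae_of_all _ fun x => ?_) 2
        rw [norm_smul, mul_comm]
        exact mul_le_mul_of_nonneg_right (hζ.norm_gradient_le x) (norm_nonneg _)

/-- The integrated form of `ζ v ∇v = ½ (∇(ζ v²) - v² ∇ζ)`: there is no boundary term because `v`
is a limit of test functions. -/
theorem MemH10.two_integral_cutoff_smul (h : MemH10 Ω v gv) (hζ : IsC1Bounded C ζ) :
    (2 : ℝ) • ∫ x in Ω, (ζ x • v x) • gv x = - ∫ x in Ω, v x • v x • gradient ζ x := by
  obtain ⟨φ, hφ, hlim, hlim'⟩ := h.approx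
  have hL2 (n : ℕ) : MemLp (φ n) 2 (volume.restrict Ω) := (hφ n).memLp _
  have h1 := tendsto_integral_smul_right (fun n => (hφ n).memLp_gradient _)
    (hζ.memLp_smul h.memLp) h.memLp_grad hlim'
  have h2 := tendsto_integral_smul_left hL2 h.memLp (hζ.memLp_smul_gradient h.memLp) hlim
  have h3 := (tendsto_integral_smul_left hL2 h.memLp (hζ.memLp_smul h.memLp_grad) hlim).neg
  have h4 := tendsto_nhds_unique
    ((h1.add h2).congr fun n => h.toMemH1.integral_cutoff hζ (hφ n)) h3
  have h5 : ∫ x in Ω, v x • ζ x • gv x = ∫ x in Ω, (ζ x • v x) • gv x :=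
    integral_congr_ae (ae_of_all _ fun x => by simp only [smul_eq_mul]; module)
  rw [h5] at h4
  rw [two_smul, eq_neg_iff_add_eq_zero, add_assoc, h4, add_neg_cancel]

/-- A cutoff that is constant along the constant field `b₀` does not see the convective term. -/
theorem MemH10.integral_convection_eq_zero (h : MemH10 Ω v gv) (hζ : IsC1Bounded C ζ) {b₀ : Euc d}
    (hb : ∀ x, inner ℝ b₀ (gradient ζ x) = 0) :
    ∫ x in Ω, (ζ x * v x) * inner ℝ b₀ (gv x) = 0 := by
  have h1 := congrArg (inner ℝ b₀) (h.two_integral_cutoff_smul hζ)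
  rw [inner_smul_right, inner_neg_right,
    ← integral_inner (integrable_smul_of_memLp_two (hζ.memLp_smul h.memLp) h.memLp_grad),
    ← integral_inner (integrable_smul_of_memLp_two h.memLp (hζ.memLp_smul_gradient h.memLp))] at h1
  simp only [inner_smul_right, hb, mul_zero, integral_zero, neg_zero, smul_eq_mul] at h1
  linarith

end Cutoff

/-! ### The energy estimate -/

section Energy

variable {d : ℕ} {D Ω : Set (Euc d)} {v η : Euc d → ℝ} {gv : Euc d → Euc d} {C : ℝ}

/-- The algebraic identity behind the sharp constant:
`∇v · ∇(η² v) = |∇(η v)|² - v² |∇η|²`. -/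
theorem inner_cutoff_sq (g h : Euc d) (t s : ℝ) :
    inner ℝ g (t ^ 2 • g + s • (2 * t) • h) = ‖t • g + s • h‖ ^ 2 - s ^ 2 * ‖h‖ ^ 2 := by
  rw [norm_add_sq_real, norm_smul, norm_smul, mul_pow, mul_pow, Real.norm_eq_abs, Real.norm_eq_abs,
    sq_abs, sq_abs]
  simp only [inner_add_right, inner_smul_right, inner_smul_left, real_inner_self_eq_norm_sq,
    RCLike.conj_to_real]
  ring

/-- Testing the equation with `η² v`: the energy identity
`ε ∫ |∇(η v)|² + ∫ β η² v² = ε ∫ v² |∇η|²`. -/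
theorem energy_identity {ε : ℝ} {b : Euc d → Euc d} {b₀ : Euc d} (hb : ∀ x, b x = b₀)
    {β : Euc d → ℝ} (hβ : MemLp β ∞ (volume.restrict Ω)) (hΩ : MeasurableSet Ω)
    (hDΩ : D ⊆ Ω) (h : MemH10 Ω v gv)
    (hharm : ∀ (φ : Euc d → ℝ) (gφ : Euc d → Euc d), MemH10 D φ gφ →
      form ε b β Ω v gv (D.indicator φ) (D.indicator gφ) = 0)
    (hη : IsC1Bounded C η) (hsupp : tsupport η ∩ Ω ⊆ D)
    (hbη : ∀ x, inner ℝ b₀ (gradient η x) = 0) :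
    ε * (∫ x in Ω, ‖η x • gv x + v x • gradient η x‖ ^ 2) + ∫ x in Ω, β x * (η x * v x) ^ 2 =
      ε * ∫ x in Ω, v x ^ 2 * ‖gradient η x‖ ^ 2 := by
  have hsupp2 : tsupport (fun x => η x ^ 2) ∩ Ω ⊆ D := by
    refine (Set.inter_subset_inter_left _ ?_).trans hsupp
    simp_rw [sq]
    exact tsupport_mul_subset_left
  have hconv := h.integral_convection_eq_zero hη.sq (b₀ := b₀) fun x => by
    rw [hη.gradient_sq, inner_smul_right, hbη, mul_zero]
  have htest := hharm _ _ (h.cutoff hη.sq hΩ hDΩ hsupp2)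
  have hA : Integrable (fun x => ‖η x • gv x + v x • gradient η x‖ ^ 2) (volume.restrict Ω) :=
    ((hη.memLp_smul h.memLp_grad).add (hη.memLp_smul_gradient h.memLp)).integrable_norm_pow
      two_ne_zero
  have hB : Integrable (fun x => v x ^ 2 * ‖gradient η x‖ ^ 2) (volume.restrict Ω) := by
    refine ((hη.memLp_smul_gradient h.memLp).integrable_norm_pow two_ne_zero).congr
      (ae_of_all _ fun x => ?_)
    simp only [norm_smul, mul_pow, Real.norm_eq_abs, sq_abs]
  have hηv : MemLp (fun x => η x * v x) 2 (volume.restrict Ω) := hη.memLp_smul h.memLp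
  have hR : Integrable (fun x => β x * (η x * v x) ^ 2) (volume.restrict Ω) := by
    have hβv : MemLp (fun x => β x * (η x * v x)) 2 (volume.restrict Ω) := hηv.mul hβ
    refine (hβv.integrable_mul hηv).congr (ae_of_all _ fun x => ?_)
    simp only [Pi.mul_apply]
    ring
  have hT : Integrable (fun x => (η x ^ 2 * v x) * inner ℝ b₀ (gv x)) (volume.restrict Ω) :=
    (hη.sq.memLp_smul h.memLp).integrable_mul (h.memLp_grad.const_inner b₀)
  have hform : ∀ x ∈ Ω,
      ε * inner ℝ (gv x) (D.indicator
          (fun x => η x ^ 2 • gv x + v x • gradient (fun y => η y ^ 2) x) x) +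
        D.indicator (fun x => η x ^ 2 * v x) x * inner ℝ (b x) (gv x) +
        β x * v x * D.indicator (fun x => η x ^ 2 * v x) x =
      ε * (‖η x • gv x + v x • gradient η x‖ ^ 2 - v x ^ 2 * ‖gradient η x‖ ^ 2) +
        (η x ^ 2 * v x) * inner ℝ b₀ (gv x) + β x * (η x * v x) ^ 2 := by
    intro x hx
    by_cases hxD : x ∈ D
    · rw [Set.indicator_of_mem hxD, Set.indicator_of_mem hxD, hη.gradient_sq, inner_cutoff_sq, hb]
      ring
    · have hxη : x ∉ tsupport η := fun h' => hxD (hsupp ⟨h', hx⟩)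
      rw [Set.indicator_of_notMem hxD, Set.indicator_of_notMem hxD,
        image_eq_zero_of_notMem_tsupport hxη, gradient_eq_zero_of_notMem_tsupport hxη]
      simp
  have hAB : Integrable (fun x => ε * (‖η x • gv x + v x • gradient η x‖ ^ 2 -
      v x ^ 2 * ‖gradient η x‖ ^ 2)) (volume.restrict Ω) := (hA.sub hB).const_mul ε
  have hABT : Integrable (fun x => ε * (‖η x • gv x + v x • gradient η x‖ ^ 2 -
      v x ^ 2 * ‖gradient η x‖ ^ 2) + (η x ^ 2 * v x) * inner ℝ b₀ (gv x))
      (volume.restrict Ω) := hAB.add hT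
  rw [form, setIntegral_congr_fun hΩ hform, integral_add hABT hR, integral_add hAB hT, integral_const_mul, integral_sub hA hB,
    hconv] at htest
  linarith

/-- Since `β ≥ 0`, the energy identity bounds `∇(η v)`, hence `∇v` where `η = 1`, by `v ∇η`; the
diffusion parameter `ε` cancels. -/
theorem energy_estimate {ε : ℝ} (hε : 0 < ε) {b : Euc d → Euc d} {b₀ : Euc d}
    (hb : ∀ x, b x = b₀)
    {β : Euc d → ℝ} (hβ : MemLp β ∞ (volume.restrict Ω))
    (hβ0 : ∀ᵐ x ∂(volume.restrict Ω), 0 ≤ β x) (hΩ : MeasurableSet Ω)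
    (hDΩ : D ⊆ Ω) (h : MemH10 Ω v gv)
    (hharm : ∀ (φ : Euc d → ℝ) (gφ : Euc d → Euc d), MemH10 D φ gφ →
      form ε b β Ω v gv (D.indicator φ) (D.indicator gφ) = 0)
    (hη : IsC1Bounded C η) (hsupp : tsupport η ∩ Ω ⊆ D)
    (hbη : ∀ x, inner ℝ b₀ (gradient η x) = 0) {L : ℝ} (hL : ∀ x, ‖gradient η x‖ ≤ L)
    {T : Set (Euc d)} (hT : IsOpen T) (hTΩ : T ⊆ Ω) (hηT : ∀ x ∈ T, η x = 1) :
    ∫ x in T, ‖gv x‖ ^ 2 ≤ L ^ 2 * ∫ x in D, v x ^ 2 := by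
  have hA : Integrable (fun x => ‖η x • gv x + v x • gradient η x‖ ^ 2) (volume.restrict Ω) :=
    ((hη.memLp_smul h.memLp_grad).add (hη.memLp_smul_gradient h.memLp)).integrable_norm_pow
      two_ne_zero
  have hgrad : ∀ x ∈ T, gradient η x = 0 := fun x hx => by
    have : η =ᶠ[𝓝 x] fun _ => 1 := eventually_of_mem (hT.mem_nhds hx) hηT
    rw [this.gradient_eq, gradient_fun_const]
  have hdissip : 0 ≤ ∫ x in Ω, β x * (η x * v x) ^ 2 :=
    integral_nonneg_of_ae (hβ0.mono fun x hx => mul_nonneg hx (sq_nonneg _))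
  have hid := energy_identity hb hβ hΩ hDΩ h hharm hη hsupp hbη
  calc ∫ x in T, ‖gv x‖ ^ 2 = ∫ x in T, ‖η x • gv x + v x • gradient η x‖ ^ 2 :=
        setIntegral_congr_fun hT.measurableSet fun x hx => by simp [hηT x hx, hgrad x hx]
    _ ≤ ∫ x in Ω, ‖η x • gv x + v x • gradient η x‖ ^ 2 :=
        setIntegral_mono_set hA (ae_of_all _ fun x => sq_nonneg _) hTΩ.eventuallyLE
    _ ≤ ∫ x in Ω, v x ^ 2 * ‖gradient η x‖ ^ 2 := le_of_mul_le_mul_left (by linarith) hε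
    _ = ∫ x in D, v x ^ 2 * ‖gradient η x‖ ^ 2 :=
        setIntegral_eq_of_subset_of_forall_sdiff_eq_zero hΩ hDΩ fun x hx => by
          rw [gradient_eq_zero_of_notMem_tsupport fun h' => hx.2 (hsupp ⟨h', hx.1⟩)]
          simp
    _ ≤ ∫ x in D, L ^ 2 * v x ^ 2 := by
        have hv : Integrable (fun x => v x ^ 2) (volume.restrict D) :=
          (h.memLp.mono_measure (Measure.restrict_mono hDΩ le_rfl)).integrable_sq
        refine integral_mono_of_nonneg (ae_of_all _ fun x => by positivity)
          (hv.const_mul _) (ae_of_all _ fun x => ?_)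
        simp only
        rw [mul_comm]
        exact mul_le_mul_of_nonneg_right (pow_le_pow_left₀ (norm_nonneg _) (hL x) 2) (sq_nonneg _)
    _ = L ^ 2 * ∫ x in D, v x ^ 2 := integral_const_mul _ _

end Energy

/-! ### Transverse coordinates and tubes -/

section Transverse

variable {m : ℕ} (R : Euc (m + 1) ≃ₗᵢ[ℝ] Euc (m + 1))

theorem norm_transverse_le (x : Euc (m + 1)) : ‖transverse R x‖ ≤ ‖x‖ := by
  rw [← R.norm_map x, EuclideanSpace.norm_eq, EuclideanSpace.norm_eq]
  refine Real.sqrt_le_sqrt ?_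
  rw [Fin.sum_univ_succ]
  simpa [transverse] using sq_nonneg (R x 0)

/-- The transverse coordinates as a continuous linear map. -/
noncomputable def transverseCLM : Euc (m + 1) →L[ℝ] Euc m :=
  LinearMap.mkContinuous
    { toFun := transverse R
      map_add' := fun x y => by ext i; simp [transverse]
      map_smul' := fun c x => by ext i; simp [transverse] }
    1 fun x => by simpa using norm_transverse_le R x

theorem transverseCLM_apply (x : Euc (m + 1)) : transverseCLM R x = transverse R x := rfl

theorem continuous_transverse : Continuous (transverse R) := (transverseCLM R).continuous

theorem lipschitzWith_transverse : LipschitzWith 1 (transverse R) := by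
  refine LipschitzWith.of_dist_le_mul fun x y => ?_
  rw [dist_eq_norm, dist_eq_norm, ← transverseCLM_apply, ← transverseCLM_apply, ← map_sub,
    NNReal.coe_one, one_mul]
  exact norm_transverse_le R _

/-- A function of the transverse coordinates is constant along the first coordinate axis. -/
theorem inner_gradient_comp_transverse {θ : Euc m → ℝ} (hθ : ContDiff ℝ ∞ θ) {b₀ : Euc (m + 1)}
    {c : ℝ} (hR : R b₀ = EuclideanSpace.single 0 c) (x : Euc (m + 1)) :
    inner ℝ b₀ (gradient (fun y => θ (transverse R y)) x) = 0 := by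
  have h0 : transverseCLM R b₀ = 0 := by
    ext i
    simp [transverseCLM_apply, transverse, hR]
  have hd : HasFDerivAt (fun y => θ (transverse R y))
      ((fderiv ℝ θ (transverse R x)).comp (transverseCLM R)) x :=
    ((hθ.differentiable (by simp)) (transverse R x)).hasFDerivAt.comp x
      (transverseCLM R).hasFDerivAt
  rw [inner_gradient_right, hd.fderiv, ContinuousLinearMap.comp_apply, h0, map_zero, map_zero]

/-- A cutoff between the tube over `S` and the tube over the `δ`-enlargement of `S`, constant along
the axis, with slope at most `L > 1 / δ`. -/
theorem exists_tube_cutoff {S : Set (Euc m)} (hne : S.Nonempty) {δ L : ℝ} (hδ : 0 < δ)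
    (hL : 1 / δ < L) {b₀ : Euc (m + 1)} {c : ℝ} (hR : R b₀ = EuclideanSpace.single 0 c) :
    ∃ η : Euc (m + 1) → ℝ, IsC1Bounded (max 1 L) η ∧ (∀ x, transverse R x ∈ S → η x = 1) ∧
      (∀ x ∈ tsupport η, transverse R x ∈ Metric.thickening δ S) ∧
      (∀ x, ‖gradient η x‖ ≤ L) ∧ ∀ x, inner ℝ b₀ (gradient η x) = 0 := by
  have hL0 : 0 ≤ L := ((one_div_pos.2 hδ).trans hL).le
  obtain ⟨θ, hθ, hone, hsupp, hle, hlip⟩ := exists_smooth_cutoff hne hδ hL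
  have hgrad (x : Euc (m + 1)) : ‖gradient (fun y => θ (transverse R y)) x‖ ≤ L := by
    have h := norm_fderiv_le_of_lipschitz ℝ (x₀ := x) (hlip.comp (lipschitzWith_transverse R))
    rw [mul_one, Real.coe_toNNReal _ hL0] at h
    rwa [gradient, LinearIsometryEquiv.norm_map]
  refine ⟨fun x => θ (transverse R x), ⟨hθ.comp (transverseCLM R).contDiff,
    fun x => (hle _).trans (le_max_left _ _), fun x => (hgrad x).trans (le_max_right _ _)⟩,
    fun x hx => hone _ hx, fun x hx => hsupp ?_, hgrad, inner_gradient_comp_transverse R hθ hR⟩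
  exact tsupport_comp_subset_preimage θ (continuous_transverse R) hx

end Transverse

end ConvectionTube

/-! ### The gradient estimate in tubes -/

theorem mainTheorem2 {m : ℕ}
    -- the bounded open set `Ω ⊆ ℝ^(m+1)`
    (Ω : Set (ConvectionTube.Euc (m + 1))) (hΩ : IsOpen Ω) (hΩb : Bornology.IsBounded Ω)
    -- the constant field `b = b₀`, whose only component in the rotated coordinates is the first
    (b : ConvectionTube.Euc (m + 1) → ConvectionTube.Euc (m + 1))
    (b₀ : ConvectionTube.Euc (m + 1)) (hb : ∀ x, b x = b₀)
    (R : ConvectionTube.Euc (m + 1) ≃ₗᵢ[ℝ] ConvectionTube.Euc (m + 1)) (c : ℝ)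
    (hR : R b₀ = EuclideanSpace.single 0 c)
    -- the reaction coefficient `β ∈ L^∞(Ω)`
    (β : ConvectionTube.Euc (m + 1) → ℝ) (hβ : MemLp β ∞ (volume.restrict Ω))
    (hdiv : ∀ᵐ x ∂(volume.restrict Ω), ConvectionTube.divergence b x / 2 - β x < 0)
    -- the diffusion parameter
    (ε : ℝ) (hε : 0 < ε)
    -- the cross section and the width of the enlargement
    (S : Set (ConvectionTube.Euc m)) (hS : IsOpen S) (hSb : Bornology.IsBounded S)
    (δ : ℝ) (hδ : 0 < δ)
    -- the tube `τ` and its transversal enlargement `τδ`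
    (τ τδ : Set (ConvectionTube.Euc (m + 1)))
    (hτ : τ = ConvectionTube.tube R Ω S)
    (hτδ : τδ = ConvectionTube.tube R Ω (Metric.cthickening δ S))
    (u : ConvectionTube.Euc (m + 1) → ℝ)
    (hu : u ∈ ConvectionTube.harmonicSpace ε b β Ω τδ) :
    MemLp u 2 (volume.restrict τδ) ∧
    (∃ g, ConvectionTube.HasWeakGradient (interior τδ) u g) ∧
    ∀ g, ConvectionTube.HasWeakGradient (interior τδ) u g →
      MemLp g 2 (volume.restrict τ) ∧
      ∫ x in τ, ‖g x‖ ^ 2 ≤ (1 / δ ^ 2) * ∫ x in τδ, (u x) ^ 2 := by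
  open ConvectionTube in
  obtain ⟨v, gv, hv, hharm, huv⟩ := hu
  have hsub : τδ ⊆ Ω := by rw [hτδ]; exact Set.inter_subset_right
  have hDΩ : interior τδ ⊆ Ω := interior_subset.trans hsub
  have hτopen : IsOpen τ := by
    rw [hτ]; exact (hS.preimage (continuous_transverse R)).inter hΩ
  have hτD : τ ⊆ interior τδ := by
    refine interior_maximal ?_ hτopen
    rw [hτ, hτδ]
    exact Set.inter_subset_inter_left _ fun x hx => Metric.self_subset_cthickening S hx
  have hmono {A B : Set (Euc (m + 1))} (h : A ⊆ B) :
      (volume.restrict A : Measure (Euc (m + 1))) ≤ volume.restrict B :=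
    Measure.restrict_mono h le_rfl
  have huD : u =ᵐ[volume.restrict (interior τδ)] v := ae_mono (hmono interior_subset) huv
  have hvδ : MemLp v 2 (volume.restrict τδ) := hv.memLp.mono_measure (hmono hsub)
  have huL : MemLp u 2 (volume.restrict τδ) := (memLp_congr_ae huv).2 hvδ
  have hvw : HasWeakGradient (interior τδ) v gv := hv.weakGradient.mono hΩ.measurableSet hDΩ
  refine ⟨huL, ⟨gv, ?_⟩, fun g hg => ?_⟩
  · refine ⟨locallyIntegrableOn_of_locallyIntegrable_restrict
      ((huL.mono_measure (hmono interior_subset)).locallyIntegrable one_le_two),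
      hvw.locallyIntegrable_grad, fun φ hφ => ?_⟩
    rw [← hvw.integral_eq φ hφ]
    refine integral_congr_ae ?_
    filter_upwards [huD] with x hx
    rw [hx]
  have hgτ : g =ᵐ[volume.restrict τ] gv :=
    ae_mono (hmono hτD) (hg.ae_eq isOpen_interior hvw huD)
  refine ⟨(memLp_congr_ae hgτ).2 (hv.memLp_grad.mono_measure (hmono (hτD.trans hDΩ))), ?_⟩
  have hlhs : ∫ x in τ, ‖g x‖ ^ 2 = ∫ x in τ, ‖gv x‖ ^ 2 :=
    integral_congr_ae (hgτ.mono fun x hx => by simp only [hx])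
  have hrhs : ∫ x in τδ, u x ^ 2 = ∫ x in τδ, v x ^ 2 :=
    integral_congr_ae (huv.mono fun x hx => by simp only [hx])
  rw [hlhs, hrhs]
  -- `Metric.infDist` to the empty set is `0`, so the cutoff is only available for `S` nonempty.
  rcases S.eq_empty_or_nonempty with rfl | hne
  · have : τ = ∅ := by rw [hτ, tube]; simp
    rw [this, setIntegral_empty]
    exact mul_nonneg (by positivity) (integral_nonneg fun x => sq_nonneg _)
  have hβ0 : ∀ᵐ x ∂(volume.restrict Ω), 0 ≤ β x := by
    have hconst : b = fun _ => b₀ := funext hb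
    filter_upwards [hdiv] with x hx
    have h0 : divergence b x = 0 := by simp [divergence, hconst]
    rw [h0] at hx
    linarith
  have hD : (∫ x in interior τδ, v x ^ 2) ≤ ∫ x in τδ, v x ^ 2 :=
    setIntegral_mono_set hvδ.integrable_sq (ae_of_all _ fun x => sq_nonneg _)
      interior_subset.eventuallyLE
  have key (L : ℝ) (hL : 1 / δ < L) : ∫ x in τ, ‖gv x‖ ^ 2 ≤ L ^ 2 * ∫ x in τδ, v x ^ 2 := by
    obtain ⟨η, hη, hone, hsupp, hgrad, hbη⟩ := exists_tube_cutoff R hne hδ hL hR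
    have hsuppD : tsupport η ∩ Ω ⊆ interior τδ := by
      have hopen : IsOpen (tube R Ω (Metric.thickening δ S)) :=
        (Metric.isOpen_thickening.preimage (continuous_transverse R)).inter hΩ
      have hsub' : tsupport η ∩ Ω ⊆ tube R Ω (Metric.thickening δ S) :=
        fun x hx => ⟨hsupp x hx.1, hx.2⟩
      refine hsub'.trans (interior_maximal ?_ hopen)
      rw [hτδ]
      exact Set.inter_subset_inter_left _ fun x hx =>
        Metric.thickening_subset_cthickening δ S hx
    refine (energy_estimate hε hb hβ hβ0 hΩ.measurableSet hDΩ hv hharm hη hsuppD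
      hbη hgrad hτopen (hτD.trans hDΩ) fun x hx => hone x ?_).trans
      (mul_le_mul_of_nonneg_left hD (sq_nonneg _))
    rw [hτ] at hx
    exact hx.1
  -- No smooth cutoff of slope exactly `1 / δ` need exist, so the constant is reached as a limit.
  have hlim : Tendsto (fun L : ℝ => L ^ 2 * ∫ x in τδ, v x ^ 2) (𝓝[>] (1 / δ))
      (𝓝 ((1 / δ) ^ 2 * ∫ x in τδ, v x ^ 2)) :=
    (((continuous_id.pow 2).mul continuous_const).tendsto _).mono_left nhdsWithin_le_nhds
  rw [← one_div_pow]
  exact ge_of_tendsto hlim (eventually_of_mem self_mem_nhdsWithin key)
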